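/- All digraphs are finite, without loops and without parallel arcs (2-cycles are allowed). A digraph is semicomplete if for any two distinct vertices $x,y$ at least one of $xy$, $yx$ is an arc. It is strong if it contains an $(s,t)$-path for every ordered pair of distinct vertices $s,t$, and it is $m$-arc-strong (for an integer $m\ge 0$) if deleting any set of at most $m-1$ of its arcs leaves a strong digraph. A digraph is eulerian if its underlying graph is connected and every vertex has in-degree equal to its out-degree. Theorem. Let $D$ be a $4$-arc-strong semicomplete digraph and let $F$ be any set of three arcs of $D$. Then $D$ has a spanning eulerian subdigraph containing no arc of $F$. Moreover, $4$ is best possible: if $f(3)$ denotes the least integer $m\ge 0$ such that, for every $m$-arc-strong semicomplete digraph $D$ and every set $F$ of three arcs of $D$, $D$ has a spanning eulerian subdigraph containing no arc of $F$, then $f(3)=4$. -/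

import Mathlib

/-! Finite digraphs are `Digraph V` on a finite vertex type `V`. A `Digraph` has no parallel arcs;
the absence of loops is required explicitly. A spanning subdigraph of `D` is `H : Digraph V`
with `H ≤ D`. -/

universe u

namespace Digraph

variable {V : Type u}

/-- The digraph has no loops. -/
def IsLoopless (D : Digraph V) : Prop := ∀ v, ¬ D.Adj v v

/-- The arc set `A(D)`: the arc from `x` to `y` is the ordered pair `(x, y)`. -/
def arcs (D : Digraph V) : Set (V × V) := {a | D.Adj a.1 a.2}

/-- The digraph `D ∖ F` obtained by deleting all arcs in `F`. -/
def deleteArcs (D : Digraph V) (F : Set (V × V)) : Digraph V where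
  Adj x y := D.Adj x y ∧ (x, y) ∉ F

/-- No pair of distinct vertices is non-adjacent. -/
def IsSemicomplete (D : Digraph V) : Prop := ∀ x y, x ≠ y → D.Adj x y ∨ D.Adj y x

/-- Every vertex can be reached from every other vertex along the arcs. -/
def IsStrong (D : Digraph V) : Prop := ∀ s t, s ≠ t → Relation.ReflTransGen D.Adj s t

/-- `D ∖ F` is strong for every set `F` of at most `k - 1` (that is, fewer than `k`) arcs. -/
def IsArcStrong (D : Digraph V) (k : ℕ) : Prop :=
  ∀ F : Set (V × V), F ⊆ D.arcs → F.encard < k → (D.deleteArcs F).IsStrong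

/-- The out-degree of a vertex (of a finite digraph). -/
noncomputable def outDegree (D : Digraph V) (v : V) : ℕ := {w | D.Adj v w}.ncard

/-- The in-degree of a vertex (of a finite digraph). -/
noncomputable def inDegree (D : Digraph V) (v : V) : ℕ := {w | D.Adj w v}.ncard

/-- A (finite) digraph is eulerian if it is connected, i.e. its underlying graph is connected,
and every vertex has its in-degree equal to its out-degree. -/
def IsEulerian (D : Digraph V) : Prop :=
  D.toSimpleGraphInclusive.Connected ∧ ∀ v, D.inDegree v = D.outDegree v

/-- `D` has a spanning eulerian subdigraph that contains no arc of `F`. -/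
def HasSpanningEulerianAvoiding (D : Digraph V) (F : Set (V × V)) : Prop :=
  ∃ H : Digraph V, H ≤ D ∧ H.IsEulerian ∧ Disjoint H.arcs F

/-- Every `m`-arc-strong semicomplete digraph has, for every set of `k` of its arcs, a spanning
eulerian subdigraph avoiding that set. The least such `m` is the number `f(k)`. -/
def ArcStrengthSuffices (k m : ℕ) : Prop :=
  ∀ (V : Type u) [Finite V] (D : Digraph V), D.IsLoopless → D.IsSemicomplete →
    D.IsArcStrong m → ∀ F : Set (V × V), F ⊆ D.arcs → F.encard = k →
      D.HasSpanningEulerianAvoiding F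

end Digraph

/-!
Let `A` be the arc set of `D` and `G = A \ F`. Among the balanced subsets of `G` (in-degree equal to
out-degree everywhere) take a largest one, `H`. Linear programming duality for circulations gives a
potential `π : V → ℤ` such that every arc of `G` outside `H` climbs at least one level of `π` and
every arc of `H` climbs at most one level (`exists_isLevelled`). So `H` contains all arcs of `G`
inside a level or leading downwards, and the arcs of `H` that leave a lower set of `π` are as many
as the arcs of `G` that enter it. As `D` is `4`-arc-strong, this yields the cut inequality
`IsRobust.four_le_add` on which all counting rests: at least `4` minus the number of arcs of `F`
entering the lower set. On the other hand, vertices of the same level in different components of `H`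
are nonadjacent in `G`, and as `D` is semicomplete each such pair uses up one of the three arcs
of `F`.

These two facts force all climbing arcs of `H` into a single component
(`IsRobust.linked_of_climbing`), and a component without climbing arcs lies inside a level, by balance. Keeping `π`, choose `H` such
that its components are as large as possible. If a vertex `q` lies in a component inside a level, a
climbing path `a, w, b` of `H` through another vertex `w` of that level could be rerouted as
`a, q, b`; the choice of `H` together with a count shows that `q` is nonadjacent to `a` or to `b`
(`IsRobust.apart_or_apart`). Splitting the rest of the level according to which of the two cases
occurs gives two lower sets left by too few arcs of `H`, which contradicts the sum of their cut
inequalities (`IsRobust.linked`). Hence `H` is connected.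

For the lower bound, the complete digraph on four vertices is `3`-arc-strong, but deleting the three
arcs that leave one vertex isolates this vertex in every eulerian subdigraph.
-/

/-! ### Potentials for graphs without positive cycles -/

namespace Digraph.ArcSet

open Finset

variable {V : Type*}

/-- The sum of the weights of the steps of a walk, given as the list of its vertices. -/
def walkWeight (w : V → V → ℤ) : List V → ℤ
  | a :: b :: l => w a b + walkWeight w (b :: l)
  | _ => 0

theorem walkWeight_append (w : V → V → ℤ) (l₁ : List V) (u : V) (l₂ : List V) :
    walkWeight w (l₁ ++ u :: l₂) = walkWeight w (l₁ ++ [u]) + walkWeight w (u :: l₂) := by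
  induction l₁ with
  | nil => simp [walkWeight]
  | cons a l ih =>
    cases l with
    | nil => simp [walkWeight]
    | cons b l => simp only [List.cons_append, walkWeight] at ih ⊢; omega

theorem walkWeight_add_eq_sum (w : V → V → ℤ) (σ : V → V) (l : List V) (u : V)
    (h : (l ++ [u]).IsChain fun a b => σ a = b) :
    walkWeight w (l ++ [u]) + w u (σ u) = ((l ++ [u]).map fun x => w x (σ x)).sum := by
  induction l with
  | nil => simp [walkWeight]
  | cons a l ih =>
    cases l with
    | nil => simp_all [walkWeight]
    | cons b l =>
      simp only [List.cons_append, List.isChain_cons_cons, walkWeight, List.map_cons,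
        List.sum_cons] at ih h ⊢
      rw [add_assoc, ih h.2, h.1]

variable [DecidableEq V]

/-- If no cyclic arrangement of steps has positive total weight, then there is a potential: the
negative of the largest weight of a path starting at a given vertex. The cyclic arrangements are
encoded as permutations, each moved vertex `v` contributing the step from `v` to `σ v`. -/
theorem exists_potential [Fintype V] (E : V → V → Prop) (w : V → V → ℤ) (hloop : ∀ v, ¬ E v v)
    (hcyc : ∀ σ : Equiv.Perm V, (∀ v, σ v ≠ v → E v (σ v)) →
      ∑ v, (if σ v = v then 0 else w v (σ v)) ≤ 0) :
    ∃ π : V → ℤ, ∀ u v, E u v → π u + w u v ≤ π v := by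
  have hmax : ∀ v, ∃ l : List V, (l.Nodup ∧ l.IsChain E ∧ l.head? = some v) ∧
      ∀ l' : List V, l'.Nodup ∧ l'.IsChain E ∧ l'.head? = some v →
        walkWeight w l' ≤ walkWeight w l := by
    intro v
    have hfin : {l : List V | l.Nodup ∧ l.IsChain E ∧ l.head? = some v}.Finite :=
      Set.Finite.subset (s := {l : List V | l.Nodup})
        (Set.finite_coe_iff.1 (inferInstanceAs (Finite {l : List V // l.Nodup}))) fun l hl => hl.1
    obtain ⟨l, hl, h⟩ := Set.exists_max_image _ (walkWeight w) hfin ⟨[v], by simp⟩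
    exact ⟨l, hl, fun l' hl' => h l' hl'⟩
  choose p hp hpmax using hmax
  refine ⟨fun v => - walkWeight w (p v), fun u v huv => ?_⟩
  obtain ⟨hnd, hch, hhd⟩ := hp v
  have huv' : u ≠ v := fun h => hloop v (h ▸ huv)
  obtain ⟨t, ht⟩ : ∃ t, p v = v :: t := by
    cases h : p v with
    | nil => simp [h] at hhd
    | cons a t => simp [h] at hhd; exact ⟨t, by rw [hhd]⟩
  by_cases hu : u ∈ p v
  · obtain ⟨l₁, l₂, hl⟩ := List.append_of_mem hu
    obtain ⟨l, rfl⟩ : ∃ l, l₁ = v :: l := by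
      cases l₁ with
      | nil => simp [ht] at hl; exact absurd hl.1.symm huv'
      | cons a l => simp [ht] at hl; exact ⟨l, by rw [hl.1]⟩
    have h1 := hpmax u (u :: l₂) (by
      rw [hl] at hnd hch
      exact ⟨(List.nodup_append.1 hnd).2.1, (List.isChain_append.1 hch).2.1, rfl⟩)
    have h2 := walkWeight_append w (v :: l) u l₂
    rw [← hl] at h2
    -- the closed part of the walk is a cycle
    have hsub : (v :: l ++ [u]).IsChain E ∧ (v :: l ++ [u]).Nodup := by
      have : v :: l ++ u :: l₂ = (v :: l ++ [u]) ++ l₂ := by simp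
      rw [this] at hl
      rw [hl] at hnd hch
      exact ⟨(List.isChain_append.1 hch).1, (List.nodup_append.1 hnd).1⟩
    set cyc := v :: l ++ [u] with hc
    set σ := cyc.formPerm with hσ
    have hlast : σ u = v := by
      have h := List.formPerm_apply_getLast v (l ++ [u])
      rwa [show (v :: (l ++ [u])).getLast (List.cons_ne_nil _ _) = u by simp] at h
    have hchain : cyc.IsChain fun a b => σ a = b := by
      rw [List.isChain_iff_getElem]
      intro i hi
      exact List.formPerm_apply_lt_getElem cyc hsub.2 i hi
    have hsum := walkWeight_add_eq_sum w σ (v :: l) u hchain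
    have hstep : ∀ x ∈ cyc, E x (σ x) := by
      intro x hx
      obtain ⟨i, hi, rfl⟩ := List.getElem_of_mem hx
      by_cases hi' : i + 1 < cyc.length
      · have h3 := List.isChain_iff_getElem.1 hsub.1 i hi'
        have h4 := List.isChain_iff_getElem.1 hchain i hi'
        rwa [h4]
      · have : cyc[i] = u := by
          have hi'' : i = cyc.length - 1 := by omega
          have hu : cyc.getLast (by simp [hc]) = u := by simp [hc]
          rw [List.getLast_eq_getElem] at hu
          simpa only [hi''] using hu
        rw [this, hlast]
        exact huv
    have hmem : ∀ x, σ x ≠ x → x ∈ cyc := fun x hx =>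
      List.mem_of_formPerm_apply_ne hx
    have hle := hcyc σ fun x hx => hstep x (hmem x hx)
    have heq : ∑ x, (if σ x = x then 0 else w x (σ x)) = (cyc.map fun x => w x (σ x)).sum := by
      rw [← List.sum_toFinset _ hsub.2, ← sum_subset (subset_univ cyc.toFinset)]
      · refine sum_congr rfl fun x hx => if_neg fun h => hloop x ?_
        have := hstep x (List.mem_toFinset.1 hx)
        rwa [h] at this
      · intro x _ hx
        exact if_pos (by_contra fun h => hx (List.mem_toFinset.2 (hmem x h)))
    rw [hlast, ← hc] at hsum
    rw [heq] at hle
    simp only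
    omega
  · have h1 := hpmax u (u :: p v) (by
      rw [ht] at hnd hch hu ⊢
      exact ⟨List.nodup_cons.2 ⟨hu, hnd⟩, List.isChain_cons_cons.2 ⟨huv, hch⟩, rfl⟩)
    simp only [ht, walkWeight] at h1 ⊢
    omega

/-! ### Balanced arc sets with a levelling -/

/-- The number of arcs of the arc set `H` with tail in `X` and head in `Y`. -/
def numArcs (H : Finset (V × V)) (X Y : Finset V) : ℕ := #{e ∈ H | e.1 ∈ X ∧ e.2 ∈ Y}

/-- In the arc set `H`, every vertex has its in-degree equal to its out-degree. -/
def Balanced (H : Finset (V × V)) : Prop := ∀ v, #{e ∈ H | e.1 = v} = #{e ∈ H | e.2 = v}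

theorem Balanced.numArcs_compl [Fintype V] {H : Finset (V × V)} (hH : Balanced H) (X : Finset V) :
    numArcs H X Xᶜ = numArcs H Xᶜ X := by
  have h1 : #{e ∈ H | e.1 ∈ X} = ∑ v ∈ X, #{e ∈ H | e.1 = v} := by
    rw [card_eq_sum_card_fiberwise (f := Prod.fst) (t := X) (by intro e he; simp_all)]
    refine sum_congr rfl fun v hv => ?_
    rw [filter_filter]
    congr 1
    ext e
    simp only [mem_filter]
    grind
  have h2 : #{e ∈ H | e.2 ∈ X} = ∑ v ∈ X, #{e ∈ H | e.2 = v} := by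
    rw [card_eq_sum_card_fiberwise (f := Prod.snd) (t := X) (by intro e he; simp_all)]
    refine sum_congr rfl fun v hv => ?_
    rw [filter_filter]
    congr 1
    ext e
    simp only [mem_filter]
    grind
  have h3 : #{e ∈ H | e.1 ∈ X} = #{e ∈ H | e.2 ∈ X} := by
    rw [h1, h2]
    exact sum_congr rfl fun v _ => hH v
  have h4 := card_filter_add_card_filter_not (s := {e ∈ H | e.1 ∈ X}) (fun e => e.2 ∈ X)
  have h5 := card_filter_add_card_filter_not (s := {e ∈ H | e.2 ∈ X}) (fun e => e.1 ∈ X)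
  rw [filter_filter, filter_filter] at h4 h5
  have h6 : #{e ∈ H | e.2 ∈ X ∧ e.1 ∈ X} = #{e ∈ H | e.1 ∈ X ∧ e.2 ∈ X} := by
    simp only [and_comm]
  have h7 : numArcs H X Xᶜ = #{e ∈ H | e.1 ∈ X ∧ e.2 ∉ X} := by simp [numArcs]
  have h8 : numArcs H Xᶜ X = #{e ∈ H | e.2 ∈ X ∧ e.1 ∉ X} := by simp [numArcs, and_comm]
  omega

theorem balanced_iff_sum {H : Finset (V × V)} :
    Balanced H ↔
      ∀ v, ∑ e ∈ H, ((if e.1 = v then 1 else 0) - (if e.2 = v then 1 else 0) : ℤ) = 0 := by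
  refine forall_congr' fun v => ?_
  rw [sum_sub_distrib, sum_boole, sum_boole, sub_eq_zero, Nat.cast_inj]

/-- `π` arranges the vertices in levels such that the balanced subset `H` of the arc set `G`
contains all arcs of `G` that do not lead to a higher level, and no arc that climbs more than one
level. -/
structure IsLevelled (G H : Finset (V × V)) (π : V → ℤ) : Prop where
  subset : H ⊆ G
  balanced : Balanced H
  mem : ∀ ⦃x y⦄, (x, y) ∈ G → π y ≤ π x → (x, y) ∈ H
  le_succ : ∀ ⦃x y⦄, (x, y) ∈ H → π y ≤ π x + 1

/-- Rerouting a balanced arc set along a permutation whose steps either use a new arc or cancel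
an old one keeps it balanced and changes its size by the weight of the permutation. -/
theorem exists_reroute [Fintype V] {G H : Finset (V × V)} (hHG : H ⊆ G) (hH : Balanced H)
    (σ : Equiv.Perm V) (hσ : ∀ v, σ v ≠ v → (v, σ v) ∈ G \ H ∨ (σ v, v) ∈ H) :
    ∃ H' ⊆ G, Balanced H' ∧ (#H' : ℤ) =
      #H + ∑ v, (if σ v = v then 0 else if (v, σ v) ∈ G \ H then 1 else -1) := by
  set S : Finset V := {v | σ v ≠ v ∧ (v, σ v) ∈ G \ H} with hS
  set T : Finset V := {v | σ v ≠ v ∧ (v, σ v) ∉ G \ H} with hT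
  set add : Finset (V × V) := S.image fun v => (v, σ v) with hadd
  set rem : Finset (V × V) := T.image fun v => (σ v, v) with hrem
  have haddG : add ⊆ G \ H := by
    intro e he
    simp only [hadd, hS, mem_image, mem_filter, mem_univ, true_and] at he
    obtain ⟨v, hv, rfl⟩ := he
    exact hv.2
  have hremH : rem ⊆ H := by
    intro e he
    simp only [hrem, hT, mem_image, mem_filter, mem_univ, true_and] at he
    obtain ⟨v, hv, rfl⟩ := he
    exact (hσ v hv.1).resolve_left hv.2
  have hdisj : Disjoint (H \ rem) add := by
    rw [disjoint_left]
    intro e he he'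
    exact (mem_sdiff.1 (haddG he')).2 (mem_sdiff.1 he).1
  have hsum : ∀ f : V × V → ℤ, ∑ e ∈ (H \ rem) ∪ add, f e = ∑ e ∈ H, f e +
      ∑ v, (if σ v = v then 0 else if (v, σ v) ∈ G \ H then f (v, σ v) else - f (σ v, v)) := by
    intro f
    have h1 : ∑ e ∈ add, f e = ∑ v ∈ S, f (v, σ v) :=
      sum_image fun a _ b _ h => (Prod.ext_iff.1 h).1
    have h2 : ∑ e ∈ rem, f e = ∑ v ∈ T, f (σ v, v) :=
      sum_image fun a _ b _ h => (Prod.ext_iff.1 h).2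
    have h3 := sum_sdiff (f := f) hremH
    rw [sum_union hdisj, h1]
    rw [h2, hT, sum_filter] at h3
    rw [hS, sum_filter, ← h3, add_assoc, ← sum_add_distrib, add_right_inj]
    refine sum_congr rfl fun v _ => ?_
    split_ifs <;> simp_all
  refine ⟨(H \ rem) ∪ add, union_subset (sdiff_subset.trans hHG) (haddG.trans sdiff_subset), ?_, ?_⟩
  · rw [balanced_iff_sum] at hH ⊢
    intro x
    rw [hsum, hH x, zero_add]
    -- the net flow is antisymmetric, so both kinds of steps contribute alike
    have : ∀ v, (if σ v = v then 0 else if (v, σ v) ∈ G \ H then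
        ((if v = x then 1 else 0) - (if σ v = x then 1 else 0) : ℤ)
        else - ((if σ v = x then 1 else 0) - (if v = x then 1 else 0))) =
        (if v = x then 1 else 0) - (if σ v = x then 1 else 0) := by
      intro v
      split_ifs <;> simp_all
    simp only [this, sum_sub_distrib]
    rw [Equiv.sum_comp σ fun v => if v = x then (1 : ℤ) else 0, sub_self]
  · have := hsum fun _ => 1
    simpa using this

/-- A largest balanced subset `H` of a loopless arc set has a levelling, namely an optimal
solution of the linear program dual to the maximisation of the size of `H`. -/
theorem exists_isLevelled [Fintype V] (G : Finset (V × V)) (hG : ∀ v, (v, v) ∉ G) :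
    ∃ H π, IsLevelled G H π := by
  classical
  obtain ⟨H, hH, hmax⟩ := exists_max_image ({H ∈ G.powerset | Balanced H}) card
    ⟨∅, by rw [mem_filter]; simp [Balanced]⟩
  simp only [mem_filter, mem_powerset] at hH hmax
  obtain ⟨π, hπ⟩ := exists_potential (fun u v => (u, v) ∈ G \ H ∨ (v, u) ∈ H)
    (fun u v => if (u, v) ∈ G \ H then 1 else -1) (by grind) (by
      intro σ hσ
      obtain ⟨H', hH', hb, hcard⟩ := exists_reroute hH.1 hH.2 σ hσ
      have := hmax H' ⟨hH', hb⟩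
      omega)
  refine ⟨H, π, hH.1, hH.2, fun x y hxy hle => ?_, fun x y hxy => ?_⟩
  · by_contra h
    have := hπ x y (Or.inl (mem_sdiff.2 ⟨hxy, h⟩))
    simp only [mem_sdiff, hxy, h, not_false_eq_true, and_self, if_true] at this
    omega
  · have := hπ y x (Or.inr hxy)
    split_ifs at this <;> omega

end Digraph.ArcSet

namespace Digraph.ArcSet

open Finset

variable {V : Type*}

/-! ### Cuts along lower sets of a levelling -/

/-- `x` and `y` lie in the same connected component of the undirected graph underlying `H`. -/
def Linked (H : Finset (V × V)) : V → V → Prop := Relation.EqvGen fun x y => (x, y) ∈ H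

namespace Linked

variable {H : Finset (V × V)} {x y z : V}

theorem of_mem (h : (x, y) ∈ H) : Linked H x y := Relation.EqvGen.rel _ _ h

theorem refl (H : Finset (V × V)) (x : V) : Linked H x x := Relation.EqvGen.refl _

theorem symm (h : Linked H x y) : Linked H y x := Relation.EqvGen.symm _ _ h

theorem trans (h : Linked H x y) (h' : Linked H y z) : Linked H x z :=
  Relation.EqvGen.trans _ _ _ h h'

/-- A relation that contains the arcs of one component contains all pairs in that component. -/
theorem of_forall_arc {r : V → V → Prop} (hr : Equivalence r) {v : V}
    (h : ∀ x y, (x, y) ∈ H → Linked H v x → r x y) (hvx : Linked H v x) : r v x := by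
  have key : ∀ x y, Linked H x y → Linked H v x → r x y := by
    intro x y hxy
    induction hxy with
    | rel x y hxy => exact h x y hxy
    | refl x => exact fun _ => hr.refl x
    | symm x y hxy ih => exact fun hy => hr.symm (ih (hy.trans (symm hxy)))
    | trans x y z hxy hyz ih₁ ih₂ => exact fun hx => hr.trans (ih₁ hx) (ih₂ (hx.trans hxy))
  exact key v x hvx (refl H v)

theorem equivalence (H : Finset (V × V)) : Equivalence (Linked H) :=
  ⟨refl H, symm, trans⟩

end Linked

variable [DecidableEq V]

/-- `x` and `y` are not joined by an arc of `G`. -/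
def Apart (G : Finset (V × V)) (x y : V) : Prop := (x, y) ∉ G ∧ (y, x) ∉ G

/-- The arcs of `F` that join `X` and `Y`, in either direction. -/
def between (F : Finset (V × V)) (X Y : Finset V) : Finset (V × V) :=
  {e ∈ F | e.1 ∈ X ∧ e.2 ∈ Y ∨ e.1 ∈ Y ∧ e.2 ∈ X}

/-- The arc set `A` is semicomplete and has at least four arcs across every cut, in each
direction; `F` has at most three arcs. -/
structure IsRobust [Fintype V] (A F : Finset (V × V)) : Prop where
  adj : ∀ ⦃x y⦄, x ≠ y → (x, y) ∈ A ∨ (y, x) ∈ A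
  four_le : ∀ X : Finset V, X.Nonempty → Xᶜ.Nonempty → 4 ≤ numArcs A Xᶜ X
  card_le : #F ≤ 3

/-- Four mutually exclusive kinds of elements of `F`. -/
theorem card_filter_four_le {α : Type*} (F : Finset α) (p₁ p₂ p₃ p₄ : α → Prop) [DecidablePred p₁]
    [DecidablePred p₂] [DecidablePred p₃] [DecidablePred p₄]
    (h₁ : ∀ e, p₁ e → ¬ p₂ e ∧ ¬ p₃ e ∧ ¬ p₄ e) (h₂ : ∀ e, p₂ e → ¬ p₃ e ∧ ¬ p₄ e)
    (h₃ : ∀ e, p₃ e → ¬ p₄ e) :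
    #{e ∈ F | p₁ e} + #{e ∈ F | p₂ e} + #{e ∈ F | p₃ e} + #{e ∈ F | p₄ e} ≤ #F := by
  have h : ∀ e ∈ F, (if p₁ e then 1 else 0) + (if p₂ e then 1 else 0) + (if p₃ e then 1 else 0) +
      (if p₄ e then 1 else 0) ≤ 1 := fun e _ => by
    have := h₁ e
    have := h₂ e
    have := h₃ e
    split_ifs <;> simp_all
  simp only [card_filter, ← sum_add_distrib]
  simpa using sum_le_sum h

/-- The arcs of `F` between three disjoint sets, and arcs leaving the union of these sets. -/
theorem card_between_pairs_le {F : Finset (V × V)} {X Y Z : Finset V} (hXY : Disjoint X Y)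
    (hXZ : Disjoint X Z) (hYZ : Disjoint Y Z) (p : V × V → Prop) [DecidablePred p]
    (hp : ∀ x y, p (x, y) → x ∉ X ∪ Y ∪ Z ∨ y ∉ X ∪ Y ∪ Z) :
    #(between F X Y) + #(between F X Z) + #(between F Y Z) + #{e ∈ F | p e} ≤ #F := by
  have e1 : ∀ z ∈ X, z ∉ Y := fun z hz => disjoint_left.1 hXY hz
  have e2 : ∀ z ∈ X, z ∉ Z := fun z hz => disjoint_left.1 hXZ hz
  have e3 : ∀ z ∈ Y, z ∉ Z := fun z hz => disjoint_left.1 hYZ hz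
  simp only [mem_union, not_or] at hp
  refine card_filter_four_le F _ _ _ p ?_ ?_ ?_ <;> rintro ⟨x, y⟩ h <;>
    have h' := hp x y <;> clear hp <;> simp only at h ⊢ <;> grind

/-- The arcs of `F` between a set `Q` and three other disjoint sets, and arcs avoiding `Q`. -/
theorem card_between_star_le {F : Finset (V × V)} {Q X Y Z : Finset V} (hX : Disjoint Q X)
    (hY : Disjoint Q Y) (hZ : Disjoint Q Z) (hXY : Disjoint X Y) (hXZ : Disjoint X Z)
    (hYZ : Disjoint Y Z) (p : V × V → Prop) [DecidablePred p]
    (hp : ∀ x y, p (x, y) → x ∉ Q ∧ y ∉ Q) :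
    #{e ∈ F | p e} + #(between F Q X) + #(between F Q Y) + #(between F Q Z) ≤ #F := by
  have e1 : ∀ z ∈ X, z ∉ Y := fun z hz => disjoint_left.1 hXY hz
  have e2 : ∀ z ∈ X, z ∉ Z := fun z hz => disjoint_left.1 hXZ hz
  have e3 : ∀ z ∈ Y, z ∉ Z := fun z hz => disjoint_left.1 hYZ hz
  have e4 : ∀ z ∈ Q, z ∉ X := fun z hz => disjoint_left.1 hX hz
  have e5 : ∀ z ∈ Q, z ∉ Y := fun z hz => disjoint_left.1 hY hz
  have e6 : ∀ z ∈ Q, z ∉ Z := fun z hz => disjoint_left.1 hZ hz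
  refine card_filter_four_le F p _ _ _ ?_ ?_ ?_ <;> rintro ⟨x, y⟩ h <;>
    have h' := hp x y <;> clear hp <;> simp only at h ⊢ <;> grind

theorem card_between_mono (F : Finset (V × V)) {X X' Y Y' : Finset V} (hX : X ⊆ X')
    (hY : Y ⊆ Y') : #(between F X Y) ≤ #(between F X' Y') :=
  card_le_card (monotone_filter_right _ fun _ _ h =>
    h.imp (fun h => ⟨hX h.1, hY h.2⟩) fun h => ⟨hY h.1, hX h.2⟩)

theorem IsLevelled.apart {G H : Finset (V × V)} {π : V → ℤ}
    (hL : IsLevelled G H π) {x y : V} (hxy : π x = π y)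
    (h : ¬ Linked H x y) : Apart G x y :=
  ⟨fun hG => h (.of_mem (hL.mem hG hxy.ge)), fun hG => h (Linked.of_mem (hL.mem hG hxy.le)).symm⟩

variable [Fintype V] {A F H : Finset (V × V)} {π : V → ℤ}

/-- Each nonadjacent pair of distinct vertices accounts for an arc of `F`. -/
theorem IsRobust.card_mul_card_le (hR : IsRobust A F) {X Y : Finset V} (hXY : Disjoint X Y)
    (h : ∀ x ∈ X, ∀ y ∈ Y, Apart (A \ F) x y) : #X * #Y ≤ #(between F X Y) := by
  rw [← card_product]
  refine card_le_card_of_injOn (fun e => if e ∈ F then e else (e.2, e.1)) ?_ ?_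
  · rintro ⟨x, y⟩ he
    simp only [coe_product, Set.mem_prod, mem_coe] at he
    have hne : x ≠ y := fun hxy => disjoint_left.1 hXY he.1 (hxy ▸ he.2)
    have h1 := h x he.1 y he.2
    have h2 := hR.adj hne
    simp only [Apart, mem_sdiff] at h1
    simp only [between, mem_coe, mem_filter]
    split_ifs with hF
    · exact ⟨hF, Or.inl he⟩
    · exact ⟨by tauto, Or.inr ⟨he.2, he.1⟩⟩
  · rintro ⟨x, y⟩ he ⟨x', y'⟩ he' heq
    simp only [coe_product, Set.mem_prod, mem_coe] at he he'
    have h1 : ∀ z ∈ X, z ∉ Y := fun z hz => disjoint_left.1 hXY hz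
    simp only at heq
    grind

/-- Every arc of `A \ F` that enters a lower set `X` belongs to `H`. -/
theorem IsRobust.four_le_add (hR : IsRobust A F) (hL : IsLevelled (A \ F) H π) {X : Finset V}
    (hX : X.Nonempty) (hX' : Xᶜ.Nonempty) (hlow : ∀ x ∈ X, ∀ y ∉ X, π x ≤ π y) :
    4 ≤ numArcs H X Xᶜ + numArcs F Xᶜ X := by
  rw [hL.balanced.numArcs_compl]
  refine (hR.four_le X hX hX').trans ?_
  unfold numArcs
  refine le_trans (card_le_card ?_) (card_union_le _ _)
  rintro ⟨x, y⟩ he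
  simp only [mem_filter, mem_compl, mem_union] at he ⊢
  by_cases hF : (x, y) ∈ F
  · exact Or.inr ⟨hF, he.2⟩
  · exact Or.inl ⟨hL.mem (mem_sdiff.2 ⟨he.1, hF⟩) (hlow y he.2.2 x he.2.1), he.2⟩

theorem IsRobust.exists_mem_leaving (hR : IsRobust A F) (hL : IsLevelled (A \ F) H π)
    {X : Finset V} (hX : X.Nonempty) (hX' : Xᶜ.Nonempty) (hlow : ∀ x ∈ X, ∀ y ∉ X, π x ≤ π y) :
    ∃ x ∈ X, ∃ y ∉ X, (x, y) ∈ H := by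
  have h1 := hR.four_le_add hL hX hX' hlow
  have h2 : numArcs F Xᶜ X ≤ #F := card_filter_le _ _
  have h3 := hR.card_le
  have h4 : 0 < numArcs H X Xᶜ := by omega
  obtain ⟨⟨x, y⟩, he⟩ := card_pos.1 h4
  simp only [mem_filter, mem_compl] at he
  exact ⟨x, he.2.1, y, he.2.2, he.1⟩

/-! ### Only one component climbs -/

/-- All arcs of `H` that climb from a level to the next one lie in the same component: two
components meeting both levels would be separated by too many nonadjacent pairs inside these
levels. -/
theorem IsRobust.linked_of_level_eq (hR : IsRobust A F) (hL : IsLevelled (A \ F) H π)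
    {a b a' b' : V} (hab : (a, b) ∈ H) (hab' : (a', b') ∈ H) (hb : π b = π a + 1)
    (hb' : π b' = π a' + 1) (ha : π a' = π a) : Linked H a a' := by
  classical
  by_contra hn
  set A₁ : Finset V := {x | π x = π a ∧ Linked H a x} with hA₁
  set A₂ : Finset V := {x | π x = π a ∧ ¬ Linked H a x} with hA₂
  set B₁ : Finset V := {x | π x = π a + 1 ∧ Linked H a x} with hB₁
  set B₂ : Finset V := {x | π x = π a + 1 ∧ ¬ Linked H a x} with hB₂
  set X : Finset V := {x | π x ≤ π a} with hX
  have h1 : 0 < #A₁ := card_pos.2 ⟨a, by simp [hA₁, Linked.refl]⟩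
  have h2 : 0 < #A₂ := card_pos.2 ⟨a', by simp [hA₂, hn, ha]⟩
  have h3 : 0 < #B₁ := card_pos.2 ⟨b, by simp [hB₁, hb, Linked.of_mem hab]⟩
  have h4 : 0 < #B₂ := card_pos.2 ⟨b', by
    simp only [hB₂, mem_filter, mem_univ, true_and]
    exact ⟨by omega, fun h => hn (h.trans (Linked.of_mem hab').symm)⟩⟩
  have h5 : #A₁ * #A₂ ≤ #(between F A₁ A₂) := by
    refine hR.card_mul_card_le (disjoint_left.2 (by simp +contextual [hA₁, hA₂])) ?_
    intro x hx y hy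
    simp only [hA₁, hA₂, mem_filter, mem_univ, true_and] at hx hy
    exact hL.apart (hx.1.trans hy.1.symm) fun h => hy.2 (hx.2.trans h)
  have h6 : #B₁ * #B₂ ≤ #(between F B₁ B₂) := by
    refine hR.card_mul_card_le (disjoint_left.2 (by simp +contextual [hB₁, hB₂])) ?_
    intro x hx y hy
    simp only [hB₁, hB₂, mem_filter, mem_univ, true_and] at hx hy
    exact hL.apart (hx.1.trans hy.1.symm) fun h => hy.2 (hx.2.trans h)
  have h7 : numArcs H X Xᶜ ≤ #A₁ * #B₁ + #A₂ * #B₂ := by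
    rw [← card_product, ← card_product]
    refine le_trans (card_le_card ?_) (card_union_le _ _)
    rintro ⟨x, y⟩ he
    simp only [hX, hA₁, hA₂, hB₁, hB₂, mem_filter, mem_compl, mem_union, mem_product, mem_univ,
      true_and] at he ⊢
    have h8 := hL.le_succ he.1
    have h9 : Linked H a x ↔ Linked H a y :=
      ⟨fun h => h.trans (.of_mem he.1), fun h => h.trans (Linked.of_mem he.1).symm⟩
    have h10 : π x = π a ∧ π y = π a + 1 := by omega
    tauto
  have h8 := hR.four_le_add hL (X := X) ⟨a, by simp [hX]⟩ ⟨b, by simp [hX, hb]⟩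
    (by intro x hx y hy; simp [hX] at hx hy; omega)
  have h9 : numArcs F Xᶜ X + #(between F A₁ A₂) + #(between F B₁ B₂) ≤ 3 := by
    have := card_filter_four_le F (fun e => e.1 ∈ Xᶜ ∧ e.2 ∈ X)
      (fun e => e.1 ∈ A₁ ∧ e.2 ∈ A₂ ∨ e.1 ∈ A₂ ∧ e.2 ∈ A₁)
      (fun e => e.1 ∈ B₁ ∧ e.2 ∈ B₂ ∨ e.1 ∈ B₂ ∧ e.2 ∈ B₁) (fun _ => False)
      (by
        simp only [hX, hA₁, hA₂, hB₁, hB₂, mem_filter, mem_compl, mem_univ, true_and]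
        intro e he
        grind)
      (by
        simp only [hA₁, hA₂, hB₁, hB₂, mem_filter, mem_univ, true_and]
        intro e he
        grind)
      (fun _ _ => not_false)
    simp only [filter_false, card_empty, add_zero] at this
    exact this.trans hR.card_le
  -- `p p' + q q' ≤ 3` and `p q + p' q' > p p' + q q'` have no solution in positive integers
  generalize #A₁ = p at *
  generalize #A₂ = p' at *
  generalize #B₁ = q at *
  generalize #B₂ = q' at *
  have e1 : p ≤ 2 := by nlinarith
  have e2 : p' ≤ 2 := by nlinarith
  have e3 : q ≤ 2 := by nlinarith
  have e4 : q' ≤ 2 := by nlinarith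
  interval_cases p <;> interval_cases p' <;> interval_cases q <;> interval_cases q' <;> omega

/-- All arcs of `H` that climb to the next level lie in the same component. -/
theorem IsRobust.linked_of_climbing (hR : IsRobust A F) (hL : IsLevelled (A \ F) H π)
    {a b a' b' : V} (hab : (a, b) ∈ H) (hab' : (a', b') ∈ H) (hb : π b = π a + 1)
    (hb' : π b' = π a' + 1) : Linked H a a' := by
  classical
  wlog h : π a ≤ π a' generalizing a b a' b'
  · exact (this hab' hab hb' hb (by omega)).symm
  have key : ∀ n : ℕ, ∀ a' b', (a', b') ∈ H → π b' = π a' + 1 → π a' = π a + n →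
      Linked H a a' := by
    intro n
    induction n with
    | zero =>
      intro a' b' hab' hb' h
      exact hR.linked_of_level_eq hL hab hab' hb hb' (by simpa using h)
    | succ n ih =>
      intro a' b' hab' hb' h
      push_cast at h
      by_contra hn
      obtain ⟨x, hx, y, hy, hxy⟩ := hR.exists_mem_leaving hL
        (X := {v | π v ≤ π a + n ∨ π v = π a + n + 1 ∧ Linked H a v})
        ⟨a, by simp⟩ ⟨a', by simp [hn, h]⟩ (by intro x hx y hy; simp at hx hy; omega)
      have h1 := hL.le_succ hxy
      simp only [mem_filter, mem_univ, true_and, not_or, not_and] at hx hy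
      rcases hx with hx | ⟨hx, hax⟩
      · exact hy.2 (by omega) ((ih x y hxy (by omega) (by omega)).trans (.of_mem hxy))
      · have h2 : π y ≠ π a + n + 1 := fun h => hy.2 h (hax.trans (.of_mem hxy))
        exact hn (hax.trans (hR.linked_of_level_eq hL hxy hab' (by omega) hb' (by omega)))
  exact key (π a' - π a).toNat a' b' hab' hb' (by omega)

/-- By balance, a component without climbing arcs lies inside a level. -/
theorem IsLevelled.eq_of_linked {G : Finset (V × V)} (hL : IsLevelled G H π) {v x : V}
    (h : ∀ x y, (x, y) ∈ H → Linked H v x → π y ≤ π x) (hx : Linked H v x) : π v = π x := by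
  classical
  refine Linked.of_forall_arc (r := fun x y => π x = π y)
    ⟨fun _ => rfl, Eq.symm, Eq.trans⟩ (fun x y hxy hvx => ?_) hx
  refine le_antisymm (not_lt.1 fun hlt => ?_) (h x y hxy hvx)
  set X : Finset V := {z | Linked H v z ∧ π z ≤ π y} with hX
  have h1 : 0 < numArcs H Xᶜ X := card_pos.2 ⟨(x, y), by
    simp only [hX, mem_filter, mem_compl, mem_univ, true_and]
    exact ⟨hxy, by omega, hvx.trans (.of_mem hxy), le_rfl⟩⟩
  rw [← hL.balanced.numArcs_compl] at h1
  obtain ⟨⟨z, t⟩, he⟩ := card_pos.1 h1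
  simp only [hX, mem_filter, mem_compl, mem_univ, true_and] at he
  exact he.2.2 ⟨he.2.1.1.trans (.of_mem he.1), (h z t he.1 he.2.1.1).trans he.2.1.2⟩

end Digraph.ArcSet

namespace Digraph.ArcSet

open Finset

variable {V : Type*} [DecidableEq V]

/-! ### Rerouting through a vertex of another component -/

/-- Replacing the climbing path `a, w, b` by `a, q, b`. -/
theorem IsLevelled.detour {G H : Finset (V × V)} {π : V → ℤ}
    (hL : IsLevelled G H π) {a w b q : V}
    (ha : (a, w) ∈ H) (hb : (w, b) ∈ H) (hwa : π w = π a + 1) (hbw : π b = π w + 1)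
    (hqw : π q = π w) (haq : (a, q) ∈ G \ H) (hqb : (q, b) ∈ G \ H) :
    IsLevelled G ((H \ {(a, w), (w, b)}) ∪ {(a, q), (q, b)}) π := by
  have hne₁ : (a, w) ≠ (w, b) := by
    intro h
    have := (Prod.ext_iff.1 h).1
    simp only at this
    rw [this] at hwa
    omega
  have hne₂ : (a, q) ≠ (q, b) := by
    intro h
    have := (Prod.ext_iff.1 h).1
    simp only at this
    rw [this] at hwa
    omega
  rw [mem_sdiff] at haq hqb
  have hsub : ({(a, w), (w, b)} : Finset (V × V)) ⊆ H := by
    simp [insert_subset_iff, ha, hb]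
  have hdisj : Disjoint (H \ {(a, w), (w, b)}) {(a, q), (q, b)} := by
    rw [disjoint_left]
    intro e he he'
    simp only [mem_insert, mem_singleton] at he'
    rcases he' with rfl | rfl
    · exact haq.2 (mem_sdiff.1 he).1
    · exact hqb.2 (mem_sdiff.1 he).1
  refine ⟨?_, ?_, ?_, ?_⟩
  · refine union_subset (sdiff_subset.trans hL.subset) ?_
    simp [insert_subset_iff, haq.1, hqb.1]
  · have hbal := balanced_iff_sum.1 hL.balanced
    rw [balanced_iff_sum]
    intro v
    have h1 := hbal v
    rw [← sum_sdiff hsub, sum_pair hne₁] at h1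
    rw [sum_union hdisj, sum_pair hne₂]
    simp only at h1 ⊢
    linarith
  · intro x y hxy hle
    have h1 := hL.mem hxy hle
    have h2 : (x, y) ≠ (a, w) := by rintro ⟨⟩; omega
    have h3 : (x, y) ≠ (w, b) := by rintro ⟨⟩; omega
    simp [h1, h2, h3]
  · intro x y hxy
    simp only [mem_union, mem_sdiff, mem_insert, mem_singleton, Prod.mk.injEq] at hxy
    rcases hxy with hxy | ⟨rfl, rfl⟩ | ⟨rfl, rfl⟩
    · exact hL.le_succ hxy.1
    · omega
    · omega

variable [Fintype V] {A F H : Finset (V × V)} {π : V → ℤ}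

/-- No other balanced arc set with the same levelling links more pairs of vertices. -/
def IsMaxLinked (G H : Finset (V × V)) (π : V → ℤ) : Prop :=
  ∀ H', IsLevelled G H' π → (∀ x y, Linked H x y → Linked H' x y) →
    ∀ x y, Linked H' x y → Linked H x y

theorem exists_isMaxLinked {G H₀ : Finset (V × V)} (h₀ : IsLevelled G H₀ π) :
    ∃ H, IsLevelled G H π ∧ IsMaxLinked G H π := by
  classical
  obtain ⟨H, hH, hmax⟩ := exists_max_image ({H ∈ G.powerset | IsLevelled G H π})
    (fun H => #{e : V × V | Linked H e.1 e.2}) ⟨H₀, by simp [h₀, h₀.subset]⟩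
  simp only [mem_filter, mem_powerset] at hH hmax
  refine ⟨H, hH.2, fun H' hH' hle x y hxy => ?_⟩
  have h1 : (univ.filter fun e : V × V => Linked H e.1 e.2) ⊆
      univ.filter fun e : V × V => Linked H' e.1 e.2 :=
    monotone_filter_right _ fun e _ => hle e.1 e.2
  have h2 := eq_of_subset_of_card_le h1 (hmax H' ⟨hH'.subset, hH'⟩)
  have h3 : (x, y) ∈ ({e : V × V | Linked H' e.1 e.2} : Finset _) := by simpa using hxy
  rw [← h2] at h3
  simpa using h3

/-- If a climbing path `a, w, b` of `H` can be rerouted through a vertex `q` of another component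
without linking more pairs, then this cuts off a set `C` containing `w`, which lies inside a level
and is joined to the other levels by no climbing arcs of `H` but `(a, w)` and `(w, b)`. -/
theorem IsRobust.exists_cut_off (hR : IsRobust A F) (hL : IsLevelled (A \ F) H π)
    (hmax : IsMaxLinked (A \ F) H π) {a w b q : V} (ha : (a, w) ∈ H) (hb : (w, b) ∈ H)
    (hwa : π w = π a + 1) (hbw : π b = π w + 1) (hqw : π q = π w)
    (hqC : ∀ x, Linked H q x → π q = π x) (hw : ¬ Linked H q w)
    (haq : ¬ Apart (A \ F) a q) (hqb : ¬ Apart (A \ F) q b) :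
    ∃ C : Finset V, w ∈ C ∧ (∀ x ∈ C, π x = π w ∧ ¬ Linked H q x) ∧
      (∀ x ∈ C, ∀ y ∉ C, π y = π w → Apart (A \ F) x y) ∧
      (∀ x ∈ C, ∀ z, (z, x) ∈ H → π x = π z + 1 → (z, x) = (a, w)) ∧
      (∀ x ∈ C, ∀ z, (x, z) ∈ H → π z = π x + 1 → (x, z) = (w, b)) := by
  classical
  have hqa' : ¬ Linked H q a := fun h => by have := hqC a h; omega
  have hqb' : ¬ Linked H q b := fun h => by have := hqC b h; omega
  have haqG : (a, q) ∈ A \ F := by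
    by_contra h
    refine haq ⟨h, fun h' => hqa' (.of_mem (hL.mem h' (by omega)))⟩
  have hqbG : (q, b) ∈ A \ F := by
    by_contra h
    refine hqb ⟨h, fun h' => hqb' (Linked.of_mem (hL.mem h' (by omega))).symm⟩
  have hL' := hL.detour ha hb hwa hbw hqw
    (mem_sdiff.2 ⟨haqG, fun h => hqa' (Linked.of_mem h).symm⟩)
    (mem_sdiff.2 ⟨hqbG, fun h => hqb' (.of_mem h)⟩)
  set H' := (H \ {(a, w), (w, b)}) ∪ {(a, q), (q, b)} with hH'
  have hmemH' : ∀ x y, (x, y) ∈ H' ↔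
      ((x, y) ∈ H ∧ (x, y) ≠ (a, w) ∧ (x, y) ≠ (w, b)) ∨ (x, y) = (a, q) ∨ (x, y) = (q, b) := by
    intro x y
    simp only [hH', mem_union, mem_sdiff, mem_insert, mem_singleton, not_or]
  have haq' : Linked H' a q := .of_mem ((hmemH' a q).2 (Or.inr (Or.inl rfl)))
  have hqb'' : Linked H' q b := .of_mem ((hmemH' q b).2 (Or.inr (Or.inr rfl)))
  -- if `w` stays linked to `a`, then `H'` links all pairs that `H` does, and also `q` and `a`
  by_cases hwa' : Linked H' a w
  · refine absurd ?_ hqa'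
    refine hmax H' hL' (fun x y hxy => ?_) q a haq'.symm
    refine Linked.of_forall_arc (Linked.equivalence H') (fun x y hxy _ => ?_) hxy
    by_cases h1 : (x, y) = (a, w)
    · cases h1; exact hwa'
    by_cases h2 : (x, y) = (w, b)
    · cases h2; exact hwa'.symm.trans (haq'.trans hqb'')
    exact .of_mem ((hmemH' x y).2 (Or.inl ⟨hxy, h1, h2⟩))
  -- otherwise the component of `w` in `H'` contains no climbing arc
  have hnot : ∀ x y, (x, y) ∈ H' → Linked H' w x → π y ≠ π x + 1 := fun x y hxy hx h =>
    hwa' ((hR.linked_of_climbing hL' ((hmemH' a q).2 (Or.inr (Or.inl rfl))) hxy (by omega)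
      h).trans hx.symm)
  have hlev : ∀ x, Linked H' w x → π w = π x := fun x hx =>
    hL'.eq_of_linked (fun x y hxy hx => by
      have h1 := hnot x y hxy hx
      have h2 := hL'.le_succ hxy
      omega) hx
  have hqx : ∀ x, Linked H q x → Linked H' q x := fun x hx =>
    Linked.of_forall_arc (Linked.equivalence H') (fun x y hxy hx => by
      refine .of_mem ((hmemH' x y).2 (Or.inl ⟨hxy, ?_, ?_⟩))
      · rintro ⟨⟩; exact hqa' hx
      · rintro ⟨⟩; exact hw hx) hx
  refine ⟨({x | Linked H' w x} : Finset V), by simp [Linked.refl], ?_, ?_, ?_, ?_⟩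
  · intro x hx
    simp only [mem_filter, mem_univ, true_and] at hx
    exact ⟨(hlev x hx).symm, fun h => hwa' (haq'.trans ((hqx x h).trans hx.symm))⟩
  · intro x hx y hy hyw
    simp only [mem_filter, mem_univ, true_and] at hx hy
    exact hL'.apart (by rw [hyw, hlev x hx]) fun h => hy (hx.trans h)
  · intro x hx z hzx hxz
    simp only [mem_filter, mem_univ, true_and] at hx
    by_contra h
    have h1 : (z, x) ≠ (w, b) := by
      rintro ⟨⟩
      have := hlev _ hx
      omega
    have h2 : (z, x) ∈ H' := (hmemH' z x).2 (Or.inl ⟨hzx, h, h1⟩)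
    exact hnot z x h2 (hx.trans (Linked.of_mem h2).symm) hxz
  · intro x hx z hxz hzx
    simp only [mem_filter, mem_univ, true_and] at hx
    by_contra h
    have h1 : (x, z) ≠ (a, w) := by
      rintro ⟨⟩
      have := hlev _ hx
      omega
    exact hnot x z ((hmemH' x z).2 (Or.inl ⟨hxz, h1, h⟩)) hx hzx

/-- A component inside a level is not skirted by a climbing path whose end vertices are both
adjacent to a vertex `q` of that component: otherwise the level would consist of three pairwise
nonadjacent parts, using up all of `F`, and rerouting two such paths would leave too few arcs
climbing into the level. -/
theorem IsRobust.apart_or_apart (hR : IsRobust A F) (hL : IsLevelled (A \ F) H π)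
    (hmax : IsMaxLinked (A \ F) H π) {a w b q : V} (ha : (a, w) ∈ H) (hb : (w, b) ∈ H)
    (hwa : π w = π a + 1) (hbw : π b = π w + 1) (hqw : π q = π w)
    (hqC : ∀ x, Linked H q x → π q = π x) (hw : ¬ Linked H q w) :
    Apart (A \ F) a q ∨ Apart (A \ F) q b := by
  classical
  by_contra hcon
  rw [not_or] at hcon
  obtain ⟨C, hwC, hClev, hCapart, hCin, hCout⟩ :=
    hR.exists_cut_off hL hmax ha hb hwa hbw hqw hqC hw hcon.1 hcon.2
  set Q : Finset V := {x | Linked H q x} with hQ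
  set Y : Finset V := {x | π x = π w ∧ ¬ Linked H q x ∧ x ∉ C} with hY
  have hqQ : q ∈ Q := by simp [hQ, Linked.refl]
  have hQlev : ∀ x ∈ Q, π x = π w := fun x hx => by
    have := hqC x (by simpa [hQ] using hx)
    omega
  have hYlev : ∀ x ∈ Y, π x = π w := fun x hx => by simp only [hY, mem_filter] at hx; exact hx.2.1
  have hCQ : Disjoint C Q := disjoint_left.2 fun x hx hxQ =>
    (hClev x hx).2 (by simpa [hQ] using hxQ)
  have hCY : Disjoint C Y := disjoint_left.2 fun x hx hxY => by
    simp only [hY, mem_filter] at hxY; exact hxY.2.2.2 hx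
  have hQY : Disjoint Q Y := disjoint_left.2 fun x hx hxY => by
    simp only [hY, hQ, mem_filter, mem_univ, true_and] at hxY hx; exact hxY.2.1 hx
  have h1 : #C * #Q ≤ #(between F C Q) := hR.card_mul_card_le hCQ fun x hx y hy =>
    hCapart x hx y (fun h => disjoint_left.1 hCQ h hy) (hQlev y hy)
  have h2 : #C * #Y ≤ #(between F C Y) := hR.card_mul_card_le hCY fun x hx y hy =>
    hCapart x hx y (fun h => disjoint_left.1 hCY h hy) (hYlev y hy)
  have h3 : #Q * #Y ≤ #(between F Q Y) := hR.card_mul_card_le hQY fun x hx y hy =>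
    hL.apart (by rw [hQlev x hx, hYlev y hy]) fun h => by
      simp only [hY, hQ, mem_filter, mem_univ, true_and] at hx hy
      exact hy.2.1 (hx.trans h)
  -- arcs of `F` that are not inside the level compete with the nonadjacent pairs in the level
  have hcount : ∀ (p : V × V → Prop) [DecidablePred p],
      (∀ x y, p (x, y) → π x ≠ π w ∨ π y ≠ π w) →
      #C * #Q + #C * #Y + #Q * #Y + #{e ∈ F | p e} ≤ 3 := by
    intro p _ hp
    have hlev : ∀ z ∈ C ∪ Q ∪ Y, π z = π w := fun z hz => by
      simp only [mem_union] at hz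
      rcases hz with (hz | hz) | hz
      · exact (hClev z hz).1
      · exact hQlev z hz
      · exact hYlev z hz
    have := card_between_pairs_le (F := F) hCQ hCY hQY p fun x y h =>
      (hp x y h).imp (fun h h' => h (hlev x h')) fun h h' => h (hlev y h')
    have h4 := hR.card_le
    omega
  have hCpos : 0 < #C := card_pos.2 ⟨w, hwC⟩
  have hQpos : 0 < #Q := card_pos.2 ⟨q, hqQ⟩
  set Lo : Finset V := {x | π x < π w} with hLo
  set Hi : Finset V := {x | π x ≤ π w} with hHi
  have hmemLo : ∀ x, x ∈ Lo ↔ π x < π w := fun x => by simp [hLo]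
  have hmemHi : ∀ x, x ∈ Hi ↔ π x ≤ π w := fun x => by simp [hHi]
  -- the arcs climbing into the level
  have hin := hR.four_le_add hL (X := Lo) ⟨a, by rw [hmemLo]; omega⟩
    ⟨w, by rw [mem_compl, hmemLo]; omega⟩ (by intro x hx y hy; rw [hmemLo] at hx hy; omega)
  have hFin := hcount (fun e => e.1 ∈ Loᶜ ∧
    e.2 ∈ Lo) (by
      intro x y h
      simp only [hmemLo] at h
      right
      omega)
  -- the arcs climbing out of the level
  have hout := hR.four_le_add hL (X := Hi) ⟨w, by rw [hmemHi]⟩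
    ⟨b, by rw [mem_compl, hmemHi]; omega⟩ (by intro x hx y hy; rw [hmemHi] at hx hy; omega)
  have hFout := hcount (fun e => e.1 ∈ Hiᶜ ∧
    e.2 ∈ Hi) (by
      intro x y h
      simp only [mem_compl, hmemHi] at h
      left
      omega)
  have hinY : ∀ x y, (x, y) ∈ H → π x < π w → ¬ π y < π w →
      π w = π x + 1 ∧ π y = π w ∧ ((x, y) = (a, w) ∨ y ∈ Y) := by
    intro x y hxy hx hy
    have e1 := hL.le_succ hxy
    refine ⟨by omega, by omega, ?_⟩
    by_cases hyC : y ∈ C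
    · exact Or.inl (hCin y hyC x hxy (by omega))
    · right
      simp only [hY, mem_filter, mem_univ, true_and]
      refine ⟨by omega, fun h => ?_, hyC⟩
      have := hqC x (h.trans (Linked.of_mem hxy).symm)
      omega
  have houtY : ∀ x y, (x, y) ∈ H → π x ≤ π w → ¬ π y ≤ π w →
      π y = π w + 1 ∧ π x = π w ∧ ((x, y) = (w, b) ∨ x ∈ Y) := by
    intro x y hxy hx hy
    have e1 := hL.le_succ hxy
    refine ⟨by omega, by omega, ?_⟩
    by_cases hxC : x ∈ C
    · exact Or.inl (hCout x hxC y hxy (by omega))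
    · right
      simp only [hY, mem_filter, mem_univ, true_and]
      refine ⟨by omega, fun h => ?_, hxC⟩
      have := hqC y (h.trans (.of_mem hxy))
      omega
  have hCQpos : 0 < #C * #Q := Nat.mul_pos hCpos hQpos
  have hinH : 1 < #{e ∈ H | e.1 ∈ Lo ∧ e.2 ∈ Loᶜ} := by
    unfold numArcs at hin
    omega
  obtain ⟨⟨a', w'⟩, he, hne⟩ := exists_mem_ne hinH (a, w)
  simp only [mem_filter, mem_compl, hmemLo] at he
  obtain ⟨ha', hw', hor⟩ := hinY a' w' he.1 he.2.1 he.2.2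
  have hw'Y := hor.resolve_left hne
  -- the three parts of the level are single vertices, and `F` lies inside the level
  have hYpos : 0 < #Y := card_pos.2 ⟨w', hw'Y⟩
  have hCYpos : 0 < #C * #Y := Nat.mul_pos hCpos hYpos
  have hQYpos : 0 < #Q * #Y := Nat.mul_pos hQpos hYpos
  have hYone : #Y = 1 := by
    have : #C * #Y ≤ 1 := by omega
    nlinarith
  have hYeq : ∀ x ∈ Y, x = w' := fun x hx => card_le_one.1 hYone.le x hx w' hw'Y
  have houtH : 1 < #{e ∈ H | e.1 ∈ Hi ∧ e.2 ∈ Hiᶜ} := by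
    unfold numArcs at hout
    omega
  obtain ⟨⟨x, b'⟩, he', hne'⟩ := exists_mem_ne houtH (w, b)
  simp only [mem_filter, mem_compl, hmemHi] at he'
  obtain ⟨hb', -, hor'⟩ := houtY x b' he'.1 he'.2.1 he'.2.2
  obtain rfl := hYeq x (hor'.resolve_left hne')
  have hadj : ∀ z, π z ≠ π w → ¬ Apart (A \ F) z q := by
    intro z hz hap
    have e1 := hR.card_mul_card_le (X := {z}) (Y := {q}) (by
      rw [disjoint_singleton]; rintro rfl; omega) (by simpa using hap)
    have e2 := hcount (fun e => e.1 ∈ ({z} : Finset V) ∧ e.2 ∈ ({q} : Finset V) ∨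
      e.1 ∈ ({q} : Finset V) ∧ e.2 ∈ ({z} : Finset V)) (by
        intro x y h
        simp only [mem_singleton] at h
        rcases h with ⟨rfl, -⟩ | ⟨-, rfl⟩ <;> tauto)
    simp only [card_singleton, between] at e1
    omega
  obtain ⟨C', hwC', -, -, hCin', -⟩ := hR.exists_cut_off hL hmax he.1 he'.1 (by omega) (by omega)
    (by omega) hqC (by simp only [hY, mem_filter] at hw'Y; exact hw'Y.2.2.1)
    (hadj a' (by omega)) fun h => hadj b' (by omega) ⟨h.2, h.1⟩
  -- by rerouting the second path as well, only two arcs climb into the level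
  have hle : numArcs H Lo Loᶜ ≤ 2 := by
    refine (card_le_card (t := {(a, w), (a', x)}) ?_).trans card_le_two
    rintro ⟨y, z⟩ hyz
    simp only [mem_filter, mem_compl, hmemLo] at hyz
    obtain ⟨hy, hz, hor⟩ := hinY y z hyz.1 hyz.2.1 hyz.2.2
    rw [mem_insert, mem_singleton]
    refine hor.imp_right fun hzY => ?_
    obtain rfl := hYeq z hzY
    exact hCin' z hwC' y hyz.1 (by omega)
  unfold numArcs at hle hin
  omega

/-- If `H` links as many pairs as possible, then it is connected. -/
theorem IsRobust.linked (hR : IsRobust A F) (hL : IsLevelled (A \ F) H π)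
    (hmax : IsMaxLinked (A \ F) H π) (s t : V) : Linked H s t := by
  classical
  by_contra hst
  -- a component without climbing arcs
  obtain ⟨q, hq, q', hqq'⟩ : ∃ q, (∀ x y, (x, y) ∈ H → Linked H q x → π y ≤ π x) ∧
      ∃ q', ¬ Linked H q q' := by
    by_cases h : ∃ a b, (a, b) ∈ H ∧ π b = π a + 1
    · obtain ⟨a, b, hab, hb⟩ := h
      have key : ∀ q, ¬ Linked H a q → ∃ q, (∀ x y, (x, y) ∈ H → Linked H q x → π y ≤ π x) ∧
          ∃ q', ¬ Linked H q q' := by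
        refine fun q hq => ⟨q, fun x y hxy hx => ?_, a, fun h => hq h.symm⟩
        by_contra hlt
        have := hL.le_succ hxy
        exact hq ((hR.linked_of_climbing hL hab hxy hb (by omega)).trans hx.symm)
      by_cases has : Linked H a s
      · exact key t fun h => hst (has.symm.trans h)
      · exact key s has
    · push Not at h
      refine ⟨s, fun x y hxy _ => ?_, t, hst⟩
      have h1 := h x y hxy
      have h2 := hL.le_succ hxy
      omega
  have hqC : ∀ x, Linked H q x → π q = π x := fun x hx => hL.eq_of_linked hq hx
  set Q : Finset V := {x | Linked H q x} with hQ
  have hmemQ : ∀ x, x ∈ Q ↔ Linked H q x := fun x => by simp [hQ]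
  have hQH : ∀ x y, (x, y) ∈ H → (x ∈ Q ↔ y ∈ Q) := fun x y hxy => by
    rw [hmemQ, hmemQ]
    exact ⟨fun h => h.trans (.of_mem hxy), fun h => h.trans (Linked.of_mem hxy).symm⟩
  set B : Finset V := {x | π x < π q} with hB
  set U : Finset V := {x | π q < π x} with hU
  have hqQ : q ∈ Q := (hmemQ q).2 (Linked.refl _ _)
  -- there are lower and higher levels, since `H` has an arc leaving any proper lower set
  have hBne : B.Nonempty := by
    by_contra h
    rw [not_nonempty_iff_eq_empty] at h
    have hlow : ∀ y, π q ≤ π y := fun y => by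
      by_contra hy
      have : y ∈ B := by simp only [hB, mem_filter, mem_univ, true_and]; omega
      simp [h] at this
    obtain ⟨x, hx, y, hy, hxy⟩ := hR.exists_mem_leaving hL (X := Q) ⟨q, hqQ⟩
      ⟨q', by simpa [hmemQ] using hqq'⟩
      fun x hx y _ => by rw [← hqC x ((hmemQ x).1 hx)]; exact hlow y
    exact hy ((hQH x y hxy).1 hx)
  have hUne : U.Nonempty := by
    by_contra h
    rw [not_nonempty_iff_eq_empty] at h
    have hhigh : ∀ y, π y ≤ π q := fun y => by
      by_contra hy
      have : y ∈ U := by simp only [hU, mem_filter, mem_univ, true_and]; omega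
      simp [h] at this
    obtain ⟨x, hx, y, hy, hxy⟩ := hR.exists_mem_leaving hL (X := Qᶜ)
      ⟨q', by simpa [hmemQ] using hqq'⟩ ⟨q, by simpa using hqQ⟩
      fun x _ y hy => by
        rw [mem_compl, not_not] at hy
        rw [← hqC y ((hmemQ y).1 hy)]
        exact hhigh x
    rw [mem_compl] at hx hy
    exact hx ((hQH x y hxy).2 (not_not.1 hy))
  -- the other vertices of the level, split by whether some arc climbing to them could lead to `q`
  set P : Finset V := {w | π w = π q ∧ w ∉ Q ∧
    ∃ a, (a, w) ∈ H ∧ π a < π q ∧ ¬ Apart (A \ F) a q} with hP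
  set R : Finset V := {w | π w = π q ∧ w ∉ Q ∧
    ¬ ∃ a, (a, w) ∈ H ∧ π a < π q ∧ ¬ Apart (A \ F) a q} with hRdef
  have hmemB : ∀ x, x ∈ B ↔ π x < π q := fun x => by simp [hB]
  have hmemU : ∀ x, x ∈ U ↔ π q < π x := fun x => by simp [hU]
  have hPR : Disjoint P R := disjoint_left.2 fun x hx hx' => by
    simp only [hP, hRdef, mem_filter, mem_univ, true_and] at hx hx'
    exact hx'.2.2 hx.2.2
  have hPlev : ∀ x ∈ P, π x = π q ∧ x ∉ Q := fun x hx => by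
    simp only [hP, mem_filter, mem_univ, true_and] at hx
    exact ⟨hx.1, hx.2.1⟩
  have hRlev : ∀ x ∈ R, π x = π q ∧ x ∉ Q := fun x hx => by
    simp only [hRdef, mem_filter, mem_univ, true_and] at hx
    exact ⟨hx.1, hx.2.1⟩
  have hcases : ∀ x, π x = π q → x ∈ Q ∨ x ∈ P ∨ x ∈ R := fun x hx => by
    by_cases hQ' : x ∈ Q
    · exact Or.inl hQ'
    right
    simp only [hP, hRdef, mem_filter, mem_univ, true_and]
    exact (em _).imp (fun h => ⟨hx, hQ', h⟩) fun h => ⟨hx, hQ', h⟩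
  set Mb : Finset V := {x ∈ B | Apart (A \ F) x q} with hMb
  set Mu : Finset V := {x ∈ U | Apart (A \ F) q x} with hMu
  have hPout : ∀ w ∈ P, ∀ b, (w, b) ∈ H → π q < π b → b ∈ Mu := by
    intro w hw b hb hqb
    simp only [hP, mem_filter, mem_univ, true_and] at hw
    obtain ⟨hwq, hwQ, a, haw, haq, hap⟩ := hw
    have e1 := hL.le_succ haw
    have e2 := hL.le_succ hb
    simp only [hMu, mem_filter, hmemU]
    exact ⟨hqb, (hR.apart_or_apart hL hmax haw hb (by omega) (by omega) hwq.symm hqC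
      fun h => hwQ ((hmemQ w).2 h)).resolve_left hap⟩
  have hRin : ∀ w ∈ R, ∀ a, (a, w) ∈ H → π a < π q → a ∈ Mb := by
    intro w hw a haw haq
    simp only [hRdef, mem_filter, mem_univ, true_and] at hw
    simp only [hMb, mem_filter, hmemB]
    refine ⟨haq, by_contra fun h => hw.2.2 ⟨a, haw, haq, h⟩⟩
  have hQlev : ∀ x ∈ Q, π x = π q := fun x hx => (hqC x ((hmemQ x).1 hx)).symm
  -- few arcs of `H` leave the two lower sets
  have hbound : ∀ X : Finset V, (∀ x ∈ X, ∀ y ∉ X, (x, y) ∈ H → x ∈ B ∪ P ∧ y ∉ B ∪ P) →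
      numArcs H X Xᶜ ≤ #P * #R + #Mb * #R + #P * #Mu := by
    intro X hX
    rw [← card_product, ← card_product, ← card_product]
    refine (card_le_card (t := P ×ˢ R ∪ Mb ×ˢ R ∪ P ×ˢ Mu) ?_).trans
      ((card_union_le _ _).trans (Nat.add_le_add_right (card_union_le _ _) _))
    rintro ⟨x, y⟩ he
    rw [mem_filter, mem_compl] at he
    obtain ⟨hxy, hx, hy⟩ := he
    obtain ⟨hx', hy'⟩ := hX x hx y hy hxy
    rw [mem_union, not_or] at hy'
    have e1 := hL.le_succ hxy
    have e2 : ¬ π y < π q := fun h => hy'.1 ((hmemB y).2 h)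
    have e3 : x ∉ Q := fun h => by
      have := hQlev x h
      rcases mem_union.1 hx' with h' | h'
      · have := (hmemB x).1 h'; omega
      · exact (hPlev x h').2 h
    have e4 : π y = π q → y ∈ R := fun h =>
      ((hcases y h).resolve_left fun h => e3 ((hQH x y hxy).2 h)).resolve_left hy'.2
    simp only [mem_union, mem_product]
    rcases mem_union.1 hx' with hxB | hxP
    · have := (hmemB x).1 hxB
      have hyR : y ∈ R := e4 (by omega)
      exact Or.inl (Or.inr ⟨hRin y hyR x hxy this, hyR⟩)
    · by_cases hyq : π y = π q
      · exact Or.inl (Or.inl ⟨hxP, e4 hyq⟩)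
      · exact Or.inr ⟨hxP, hPout x hxP y hxy (by omega)⟩
  obtain ⟨b₀, hb₀⟩ := hBne
  obtain ⟨u₀, hu₀⟩ := hUne
  have hlow : ∀ X : Finset V, B ⊆ X → (∀ x ∈ X, π x ≤ π q) → ∀ x ∈ X, ∀ y ∉ X, π x ≤ π y :=
    fun X hBX hX x hx y hy => (hX x hx).trans (not_lt.1 fun h => hy (hBX ((hmemB y).2 h)))
  have hu₀' := (hmemU u₀).1 hu₀
  have hBPQ : ∀ x ∈ B ∪ P ∪ Q, π x ≤ π q := fun x hx => by
    rcases mem_union.1 hx with hx | hx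
    · rcases mem_union.1 hx with hx | hx
      · exact ((hmemB x).1 hx).le
      · exact (hPlev x hx).1.le
    · exact (hQlev x hx).le
  have hBP : ∀ x ∈ B ∪ P, π x ≤ π q := fun x hx => hBPQ x (mem_union_left _ hx)
  have hcut₁ := hR.four_le_add hL (X := B ∪ P) ⟨b₀, mem_union_left _ hb₀⟩
    ⟨u₀, mem_compl.2 fun h => by have := hBP u₀ h; omega⟩ (hlow _ subset_union_left hBP)
  have hcut₂ := hR.four_le_add hL (X := B ∪ P ∪ Q)
    ⟨b₀, mem_union_left _ (mem_union_left _ hb₀)⟩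
    ⟨u₀, mem_compl.2 fun h => by have := hBPQ u₀ h; omega⟩
    (hlow _ (subset_union_left.trans subset_union_left) hBPQ)
  have hb₁ := hbound (B ∪ P) fun x hx y hy _ => ⟨hx, hy⟩
  have hb₂ := hbound (B ∪ P ∪ Q) fun x hx y hy hxy =>
    ⟨(mem_union.1 hx).resolve_right fun h => hy (mem_union_right _ ((hQH x y hxy).1 h)),
      fun h => hy (mem_union_left _ h)⟩
  -- count the arcs of `F`
  have hQW : #P + #R ≤ #(between F Q (P ∪ R)) := by
    refine le_trans ?_ (hR.card_mul_card_le ?_ fun x hx y hy => ?_)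
    · rw [card_union_of_disjoint hPR]
      exact Nat.le_mul_of_pos_left _ (card_pos.2 ⟨q, hqQ⟩)
    · exact disjoint_left.2 fun x hx hx' => (mem_union.1 hx').elim (fun h => (hPlev x h).2 hx)
        fun h => (hRlev x h).2 hx
    · have hy' := (mem_union.1 hy).elim (hPlev y) (hRlev y)
      exact hL.apart (by rw [hQlev x hx, hy'.1]) fun h =>
        hy'.2 ((hmemQ y).2 (((hmemQ x).1 hx).trans h))
  have hMb' : #Mb ≤ #(between F Q Mb) := by
    refine le_trans (le_trans (by simp) (hR.card_mul_card_le (X := {q}) (Y := Mb) ?_ ?_))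
      (card_between_mono F (singleton_subset_iff.2 hqQ) subset_rfl)
    · rw [disjoint_singleton_left]; simp [hMb, hB]
    · simp +contextual [hMb, Apart]
  have hMu' : #Mu ≤ #(between F Q Mu) := by
    refine le_trans (le_trans (by simp) (hR.card_mul_card_le (X := {q}) (Y := Mu) ?_ ?_))
      (card_between_mono F (singleton_subset_iff.2 hqQ) subset_rfl)
    · rw [disjoint_singleton_left]; simp [hMu, hU]
    · simp +contextual [hMu]
  have hF₁ : numArcs F (B ∪ P)ᶜ (B ∪ P) + numArcs F (B ∪ P ∪ Q)ᶜ (B ∪ P ∪ Q) ≤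
      #F + numArcs F (B ∪ P ∪ Q)ᶜ (B ∪ P) := by
    unfold numArcs
    rw [← card_union_add_card_inter]
    refine Nat.add_le_add (card_le_card (union_subset (filter_subset _ _) (filter_subset _ _)))
      (card_le_card fun e he => ?_)
    simp only [mem_inter, mem_filter] at he ⊢
    exact ⟨he.1.1, he.2.2.1, he.1.2.2⟩
  have hMblt : ∀ x ∈ Mb, π x < π q := fun x hx => (hmemB x).1 (mem_filter.1 hx).1
  have hMult : ∀ x ∈ Mu, π q < π x := fun x hx => (hmemU x).1 (mem_filter.1 hx).1
  have hPRlev : ∀ x ∈ P ∪ R, π x = π q ∧ x ∉ Q := fun x hx =>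
    (mem_union.1 hx).elim (hPlev x) (hRlev x)
  have hF₂ : numArcs F (B ∪ P ∪ Q)ᶜ (B ∪ P) + #(between F Q Mb) + #(between F Q Mu) +
      #(between F Q (P ∪ R)) ≤ #F := by
    refine card_between_star_le ?_ ?_ ?_ ?_ ?_ ?_ _ ?_
    · exact disjoint_left.2 fun x hx hx' => by have := hQlev x hx; have := hMblt x hx'; omega
    · exact disjoint_left.2 fun x hx hx' => by have := hQlev x hx; have := hMult x hx'; omega
    · exact disjoint_left.2 fun x hx hx' => (hPRlev x hx').2 hx
    · exact disjoint_left.2 fun x hx hx' => by have := hMblt x hx; have := hMult x hx'; omega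
    · exact disjoint_left.2 fun x hx hx' => by have := hMblt x hx; have := hPRlev x hx'; omega
    · exact disjoint_left.2 fun x hx hx' => by have := hMult x hx; have := hPRlev x hx'; omega
    · intro x y h
      refine ⟨fun hx => mem_compl.1 h.1 (mem_union_right _ hx), fun hy => ?_⟩
      rcases mem_union.1 h.2 with h | h
      · have := (hmemB y).1 h; have := hQlev y hy; omega
      · exact (hPlev y h).2 hy
  -- Adding the two cut inequalities gives `2 (p r + mb r + p mu) ≥ 5 - o`, where `o` counts the
  -- arcs of `F` entering both lower sets, while `o + mb + mu + p + r ≤ 3`.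
  have hF₃ := hR.card_le
  have hp : #P ≤ 3 := by omega
  have hr : #R ≤ 3 := by omega
  generalize #P = p at *
  generalize #R = r at *
  generalize #Mb = mb at *
  generalize #Mu = mu at *
  interval_cases p <;> interval_cases r <;> omega

end Digraph.ArcSet

/-! ### Digraphs -/

namespace Digraph

open Finset

/-- The arc sets of the digraph and of `F` satisfy the hypotheses of the counting argument. -/
theorem IsArcStrong.isRobust {V : Type u} [Fintype V] [DecidableEq V] {D : Digraph V}
    (hs : D.IsSemicomplete) (h4 : D.IsArcStrong 4) {A F : Finset (V × V)}
    (hA : ∀ x y, (x, y) ∈ A ↔ D.Adj x y) (hF : #F ≤ 3) : ArcSet.IsRobust A F := by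
  refine ⟨fun x y hxy => by simpa only [hA] using hs x y hxy, fun X hX hX' => ?_, hF⟩
  by_contra hlt
  obtain ⟨t, ht⟩ := hX
  obtain ⟨s, hs'⟩ := hX'
  have h := h4 (({e ∈ A | e.1 ∈ Xᶜ ∧ e.2 ∈ X} : Finset (V × V)) : Set (V × V))
    (fun e he => (hA _ _).1 (mem_filter.1 (mem_coe.1 he)).1)
    (by
      rw [Set.encard_coe_eq_coe_finsetCard]
      exact_mod_cast not_le.1 hlt)
    s t (fun h => mem_compl.1 hs' (h ▸ ht))
  have key : ∀ z, Relation.ReflTransGen (D.deleteArcs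
      (({e ∈ A | e.1 ∈ Xᶜ ∧ e.2 ∈ X} : Finset (V × V)) : Set (V × V))).Adj s z → z ∈ Xᶜ := by
    intro z hz
    induction hz with
    | refl => exact hs'
    | @tail x y _ hxy ih =>
      by_contra hy
      refine hxy.2 ?_
      simp only [coe_filter, Set.mem_ofPred_eq]
      exact ⟨(hA _ _).2 hxy.1, ih, by simpa using hy⟩
  exact mem_compl.1 (key t h) ht

theorem hasSpanningEulerianAvoiding_of_isArcStrong_four {V : Type u} [Finite V] (D : Digraph V)
    (hl : D.IsLoopless) (hs : D.IsSemicomplete) (h4 : D.IsArcStrong 4) (F : Set (V × V))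
    (hF : F.encard = 3) : D.HasSpanningEulerianAvoiding F := by
  classical
  have := Fintype.ofFinite V
  set A : Finset (V × V) := {e | D.Adj e.1 e.2}
  have hA : ∀ x y, (x, y) ∈ A ↔ D.Adj x y := fun x y => by simp [A]
  have hF' : #F.toFinset ≤ 3 := by
    rw [Set.encard_eq_coe_toFinset_card] at hF
    exact (Nat.cast_inj.1 hF).le
  have hR := IsArcStrong.isRobust hs h4 hA hF'
  obtain ⟨H₀, π, h₀⟩ := ArcSet.exists_isLevelled (A \ F.toFinset) fun v hv =>
    hl v ((hA v v).1 (mem_sdiff.1 hv).1)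
  obtain ⟨H, hL, hmax⟩ := ArcSet.exists_isMaxLinked h₀
  have hlinked := hR.linked hL hmax
  have hne : Nonempty V := by
    obtain ⟨e, -⟩ := Set.nonempty_of_encard_ne_zero (s := F) (by rw [hF]; norm_num)
    exact ⟨e.1⟩
  refine ⟨⟨fun x y => (x, y) ∈ H⟩, fun x y hxy => ?_, ⟨⟨fun s t => ?_⟩, fun v => ?_⟩, ?_⟩
  · exact (hA x y).1 (mem_sdiff.1 (hL.subset hxy)).1
  · induction hlinked s t with
    | rel x y hxy =>
      refine SimpleGraph.Adj.reachable ((SimpleGraph.fromRel_adj _ _ _).2 ⟨?_, Or.inl hxy⟩)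
      rintro rfl
      exact hl _ ((hA _ _).1 (mem_sdiff.1 (hL.subset hxy)).1)
    | refl x => exact .refl x
    | symm x y _ ih => exact ih.symm
    | trans x y z _ _ ih₁ ih₂ => exact ih₁.trans ih₂
  · have h1 : ({w | (v, w) ∈ H} : Set V).ncard = #{e ∈ H | e.1 = v} := by
      rw [← Set.ncard_coe_finset, ← Set.ncard_image_of_injective _ (Prod.mk_right_injective v)]
      congr 1
      ext ⟨x, y⟩
      simp only [Set.mem_image, Set.mem_ofPred_eq, coe_filter, Prod.mk.injEq]
      grind
    have h2 : ({w | (w, v) ∈ H} : Set V).ncard = #{e ∈ H | e.2 = v} := by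
      rw [← Set.ncard_coe_finset, ← Set.ncard_image_of_injective _ (Prod.mk_left_injective v)]
      congr 1
      ext ⟨x, y⟩
      simp only [Set.mem_image, Set.mem_ofPred_eq, coe_filter, Prod.mk.injEq]
      grind
    exact h2.trans ((hL.balanced v).symm.trans h1.symm)
  · rw [Set.disjoint_left]
    intro e he heF
    exact (mem_sdiff.1 (hL.subset (show (e.1, e.2) ∈ H from he))).2 (Set.mem_toFinset.2 heF)

theorem IsArcStrong.mono {V : Type u} {D : Digraph V} {k m : ℕ} (h : D.IsArcStrong k)
    (hmk : m ≤ k) : D.IsArcStrong m :=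
  fun F hF hlt => h F hF (hlt.trans_le (by exact_mod_cast hmk))

/-- The complete digraph on four vertices is `3`-arc-strong: from `s` to `t` there are three
arc-disjoint paths of length at most two. -/
theorem isArcStrong_three_of_card_eq_four {V : Type u} [Fintype V] (hV : Fintype.card V = 4) :
    IsArcStrong (⟨fun x y => x ≠ y⟩ : Digraph V) 3 := by
  classical
  intro F _ hF s t hst
  by_contra hn
  have hdir : ∀ x y, x ≠ y → (x, y) ∉ F →
      Relation.ReflTransGen (deleteArcs (⟨fun x y => x ≠ y⟩ : Digraph V) F).Adj x y :=
    fun x y hxy h => .single ⟨hxy, h⟩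
  have hst' : (s, t) ∈ F := by_contra fun h => hn (hdir s t hst h)
  have hvia : ∀ x, x ≠ s → x ≠ t → ∃ e ∈ F, e = (s, x) ∨ e = (x, t) := by
    intro x hxs hxt
    by_contra h
    push Not at h
    exact hn ((hdir s x hxs.symm fun h' => (h _ h').1 rfl).trans
      (hdir x t hxt fun h' => (h _ h').2 rfl))
  obtain ⟨x, hx⟩ : ∃ x, x ∉ ({s, t} : Finset V) := by
    by_contra h
    push Not at h
    have := card_le_two (a := s) (b := t)
    rw [eq_univ_of_forall h, card_univ] at this
    omega
  obtain ⟨y, hy⟩ : ∃ y, y ∉ ({x, s, t} : Finset V) := by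
    by_contra h
    push Not at h
    have := card_le_three (a := x) (b := s) (c := t)
    rw [eq_univ_of_forall h, card_univ] at this
    omega
  simp only [mem_insert, mem_singleton, not_or] at hx hy
  obtain ⟨e, he, he'⟩ := hvia x hx.1 hx.2
  obtain ⟨f, hf, hf'⟩ := hvia y hy.2.1 hy.2.2
  have hsub : ({(s, t), e, f} : Set (V × V)) ⊆ F := by
    rintro z (rfl | rfl | rfl) <;> assumption
  have hcard : ({(s, t), e, f} : Set (V × V)).encard = 3 := by
    refine Set.encard_eq_three.2 ⟨(s, t), e, f, ?_, ?_, ?_, rfl⟩ <;>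
      rcases he' with rfl | rfl <;> rcases hf' with rfl | rfl <;> grind
  have := Set.encard_le_encard hsub
  rw [hcard] at this
  exact absurd hF (not_lt.2 this)

/-- Deleting the three arcs leaving a vertex of the complete digraph on four vertices isolates
this vertex in every eulerian subdigraph. -/
theorem not_arcStrengthSuffices_three {m : ℕ} (hm : m ≤ 3) : ¬ ArcStrengthSuffices.{u} 3 m := by
  intro h
  let v : Fin 4 → ULift.{u} (Fin 4) := ULift.up
  have hv : Function.Injective v := ULift.up_injective
  obtain ⟨H, hHD, ⟨hconn, hbal⟩, hdisj⟩ := h (ULift.{u} (Fin 4)) ⟨fun x y => x ≠ y⟩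
    (fun x hx => hx rfl) (fun x y hxy => Or.inl hxy)
    ((isArcStrong_three_of_card_eq_four (by simp)).mono hm)
    {(v 0, v 1), (v 0, v 2), (v 0, v 3)}
    (by
      rintro e (rfl | rfl | rfl) <;> exact hv.ne (by decide))
    (Set.encard_eq_three.2 ⟨_, _, _, by simp [hv.eq_iff], by simp [hv.eq_iff],
      by simp [hv.eq_iff], rfl⟩)
  have hout : ∀ y, ¬ H.Adj (v 0) y := by
    intro y hy
    refine Set.disjoint_left.1 hdisj (show (v 0, y) ∈ H.arcs from hy) ?_
    have hne : v 0 ≠ y := hHD hy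
    obtain ⟨i⟩ := y
    fin_cases i <;> simp_all [v]
  have hin : ∀ y, ¬ H.Adj y (v 0) := by
    intro y hy
    have h0 : H.outDegree (v 0) = 0 := by simp [outDegree, hout]
    have h1 := hbal (v 0)
    rw [h0, inDegree, Set.ncard_eq_zero] at h1
    exact (Set.eq_empty_iff_forall_notMem.1 h1 y) hy
  obtain ⟨y, hy⟩ := hconn.preconnected.exists_adj_of_nontrivial (v 0)
  rcases ((SimpleGraph.fromRel_adj _ _ _).1 hy).2 with h | h
  · exact hout y h
  · exact hin y h

end Digraph

theorem mainTheorem8 :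
    (∀ (V : Type u) [Finite V] (D : Digraph V), D.IsLoopless → D.IsSemicomplete →
      D.IsArcStrong 4 → ∀ F : Set (V × V), F ⊆ D.arcs → F.encard = 3 →
        D.HasSpanningEulerianAvoiding F) ∧
    IsLeast {m : ℕ | Digraph.ArcStrengthSuffices.{u} 3 m} 4 := by
  have h := @Digraph.hasSpanningEulerianAvoiding_of_isArcStrong_four.{u}
  refine ⟨fun V _ D hl hs h4 F _ hF => h D hl hs h4 F hF,
    fun V _ D hl hs h4 F _ hF => h D hl hs h4 F (by exact_mod_cast hF), fun m hm => ?_⟩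
  by_contra hlt
  exact Digraph.not_arcStrengthSuffices_three (by omega) hm
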